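/- Let $Q$ be the Hopf $*$-algebra of a compact quantum group, that is, a Hopf $*$-algebra over $\mathbb{C}$ (with comultiplication $\Delta$, counit $\varepsilon$, antipode $S$) that is spanned by the matrix coefficients of its finite-dimensional unitary corepresentations (unitary matrices $t\in M_n(Q)$ with $\Delta(t_{ij})=\sum_l t_{il}\otimes t_{lj}$ and $\varepsilon(t_{ij})=\delta_{ij}$). Let $A$ be a unital commutative $\mathbb{C}$-algebra generated, as a unital algebra, by a finite-dimensional subspace $V\subseteq A$ that is quadratically independent: the natural linear map $S^2V=(V\otimes V)/(v\otimes w-w\otimes v)_{v,w\in V}\to A$, $v\otimes w\mapsto vw$, is injective. Let $\alpha:A\to A\otimes Q$ be a coaction of $Q$ on $A$ (a unital algebra homomorphism with $(\alpha\otimes\mathrm{id})\alpha=(\mathrm{id}\otimes\Delta)\alpha$ and $(\mathrm{id}\otimes\varepsilon)\alpha=\mathrm{id}$) that leaves $V$ invariant, $\alpha(V)\subseteq V\otimes Q$, and is inner-faithful: there is no proper Hopf subalgebra $H\subsetneq Q$ with $\alpha(A)\subseteq A\otimes H$. Then $Q$ is commutative. -/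

import Mathlib

open scoped TensorProduct

universe u v w

section Algebraic

variable {k : Type u} [Field k] {A : Type v} [CommRing A] [Algebra k A]
  {Q : Type w} [Ring Q] [HopfAlgebra k Q]

/-- The relations `v ⊗ w - w ⊗ v` in `V ⊗ V`. -/
def symRel (k : Type u) [Field k] (V : Type v) [AddCommGroup V] [Module k V] :
    Submodule k (V ⊗[k] V) :=
  Submodule.span k {x | ∃ v w : V, x = v ⊗ₜ[k] w - w ⊗ₜ[k] v}

/-- `S²V = (V ⊗ V) / (v ⊗ w - w ⊗ v)`. -/
abbrev SymSq (k : Type u) [Field k] (V : Type v) [AddCommGroup V] [Module k V] : Type v :=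
  (V ⊗[k] V) ⧸ symRel k V

theorem symRel_le_ker {V : Type v} [AddCommGroup V] [Module k V] (f : V →ₗ[k] A) :
    symRel k V ≤ LinearMap.ker (LinearMap.mul' k A ∘ₗ TensorProduct.map f f) := by
  refine Submodule.span_le.2 ?_
  rintro _ ⟨v, w, rfl⟩
  simp [mul_comm]

/-- For a linear map `f : V → A`, the induced linear map `S²V → A`, `v ⊗ w ↦ f v * f w`. -/
noncomputable def symSqToAlgebra {V : Type v} [AddCommGroup V] [Module k V] (f : V →ₗ[k] A) :
    SymSq k V →ₗ[k] A :=
  (symRel k V).liftQ (LinearMap.mul' k A ∘ₗ TensorProduct.map f f) (symRel_le_ker f)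

/-- The subspace `V ⊆ A` is quadratically independent: the natural map `S²V → A`,
`v ⊗ w ↦ v w`, is one-to-one. -/
def QuadraticallyIndependent (V : Submodule k A) : Prop :=
  Function.Injective (symSqToAlgebra V.subtype)

/-- A (right) coaction of the Hopf algebra `Q` on the algebra `A`, that is, the structure of a
`Q`-comodule algebra on `A`. -/
structure HopfCoaction (k : Type u) [Field k] (A : Type v) [CommRing A] [Algebra k A]
    (Q : Type w) [Ring Q] [HopfAlgebra k Q] where
  /-- the underlying unital algebra map -/
  toAlgHom : A →ₐ[k] A ⊗[k] Q
  /-- `(α ⊗ id) α = (id ⊗ Δ) α` -/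
  coassoc : ∀ a : A,
    TensorProduct.assoc k A Q Q (toAlgHom.toLinearMap.rTensor Q (toAlgHom a)) =
      (Coalgebra.comul (R := k) (A := Q)).lTensor A (toAlgHom a)
  /-- `(id ⊗ ε) α = id` -/
  counit : ∀ a : A,
    TensorProduct.rid k A ((Coalgebra.counit (R := k) (A := Q)).lTensor A (toAlgHom a)) = a

/-- A subalgebra `H` of `Q` is a Hopf subalgebra: `Δ(H) ⊆ H ⊗ H` and `S(H) ⊆ H`. -/
structure IsHopfSubalgebra (H : Subalgebra k Q) : Prop where
  comul_mem : ∀ h ∈ H, Coalgebra.comul (R := k) h ∈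
    LinearMap.range
      (TensorProduct.map (Subalgebra.toSubmodule H).subtype (Subalgebra.toSubmodule H).subtype)
  antipode_mem : ∀ h ∈ H, HopfAlgebra.antipode k h ∈ H

/-- The coaction leaves `V` invariant: `α(V) ⊆ V ⊗ Q`. -/
def HopfCoaction.Preserves (α : HopfCoaction k A Q) (V : Submodule k A) : Prop :=
  ∀ v ∈ V, α.toAlgHom v ∈ LinearMap.range (V.subtype.rTensor Q)

/-- The coaction factors through the subalgebra `H`: `α(A) ⊆ A ⊗ H`. -/
def HopfCoaction.FactorsThrough (α : HopfCoaction k A Q) (H : Subalgebra k Q) : Prop :=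
  ∀ a : A, α.toAlgHom a ∈ LinearMap.range ((Subalgebra.toSubmodule H).subtype.lTensor A)

/-- The coaction is inner-faithful: it does not factor through a proper Hopf subalgebra. -/
def HopfCoaction.InnerFaithful (α : HopfCoaction k A Q) : Prop :=
  ∀ H : Subalgebra k Q, IsHopfSubalgebra H → α.FactorsThrough H → H = ⊤

end Algebraic

section CompactQuantumGroup

variable (Q : Type w) [Ring Q] [HopfAlgebra ℂ Q] [StarRing Q] [StarModule ℂ Q]

/-- `Q`, with its conjugate-linear antimultiplicative involution, is a Hopf `*`-algebra: the
comultiplication is a `*`-map into `Q ⊗ Q`, where `(a ⊗ b)^* = a^* ⊗ b^*`. The identities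
`ε(a^*) = conj ε(a)` and `S(S(a^*)^*) = a` are consequences. -/
def IsHopfStarAlgebra : Prop :=
  ∀ a : Q, Coalgebra.comul (R := ℂ) (star a) = star (Coalgebra.comul (R := ℂ) a)

variable {Q} in
/-- A finite-dimensional unitary corepresentation, given by a unitary matrix `t` over `Q` with
`Δ(t i j) = ∑ l, t i l ⊗ t l j` and `ε(t i j) = δ i j`. -/
structure IsUnitaryCorep {n : ℕ} (t : Matrix (Fin n) (Fin n) Q) : Prop where
  comul_eq : ∀ i j, Coalgebra.comul (R := ℂ) (t i j) = ∑ l, t i l ⊗ₜ[ℂ] t l j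
  counit_eq : ∀ i j, Coalgebra.counit (R := ℂ) (t i j) = if i = j then 1 else 0
  unitary : t ∈ unitary (Matrix (Fin n) (Fin n) Q)

/-- `Q` is the Hopf `*`-algebra of a compact quantum group: a Hopf `*`-algebra which is the linear
span of the matrix coefficients of its finite-dimensional unitary corepresentations
(a "CQG algebra"). -/
structure IsCompactQuantumGroupAlgebra : Prop where
  hopfStar : IsHopfStarAlgebra Q
  span_coeff : Submodule.span ℂ
    {x : Q | ∃ (n : ℕ) (t : Matrix (Fin n) (Fin n) Q) (i j : Fin n),
      IsUnitaryCorep t ∧ x = t i j} = ⊤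

end CompactQuantumGroup

/-!
Choose a basis `e` of `V` and write `α (e j) = ∑ i, e i ⊗ u i j`. Since `A` is commutative,
`α (e i) α (e j) = α (e j) α (e i)`; as `V` is quadratically independent, the coefficients of
this identity can be compared after symmetrization, which gives
`[u a i, u b j] = [u a j, u b i]` (`HopfCoaction.IsCoeffMatrix.commutator_swap`). If `u` is
unitary, so that `S (u i j) = (u j i)^*`, then applying `x ↦ S(x)^*`, which is multiplicative and
transposes `u`, turns this into `[u a i, u b j] = [u b i, u a j] = -[u a j, u b i]`. Hence all
`u a i` commute (`HopfCoaction.IsCoeffMatrix.commute`).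

An element commuting with the entries of a matrix commutes with the entries of its inverse, so the
`u i j` also commute with the `(u i j)^*`. The subalgebra generated by the `u i j` and the
`(u i j)^*` is therefore commutative; it is a Hopf subalgebra through which `α` factors, so it is
all of `Q` by inner-faithfulness.

It remains to find a basis of `V` in which `u` is unitary
(`HopfCoaction.Preserves.exists_isCoeffMatrix_antipode_eq_star`). No Haar state is needed. The dual
algebra `Q'` acts on `V` by `ψ · v = (id ⊗ ψ) α(v)` and carries the involution
`ψ ↦ conj ψ(S(·)^*)`; a basis with unitary coefficient matrix is an orthonormal basis for an inner
product on `V` for which this action is compatible with adjoints. The coefficients of `V` lie in the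
span of the entries of one matrix `t`, a direct sum of unitary corepresentations. Evaluating on the
entries of `t` maps a direct sum of copies of `Q'` equivariantly to a finite-dimensional Hilbert
space `W` on which `Q'` acts by `t`, compatibly with adjoints, and the surjection from this direct
sum onto `V` factors through its image in `W`. So `V` is a quotient of an invariant subspace of `W`,
hence isomorphic to an orthogonal complement inside `W`
(`exists_basis_conjTranspose_of_adjoint_family`).
-/

/-! ### Quotients of families of operators closed under adjoints -/

/-- Let the operators `T i` on a Hilbert space satisfy `(T i)^* = T (σ i)`. A subquotient of this
family, presented as the image of `f` where `ker g ⊆ ker f` for an equivariant map `g` into the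
Hilbert space, has a basis in which the matrix of `σ i` is the conjugate transpose of that of `i`.
The basis is the image of an orthonormal basis of `range g ⊖ g (ker f)`. -/
theorem exists_basis_conjTranspose_of_adjoint_family {ι W X Y : Type*}
    [NormedAddCommGroup W] [InnerProductSpace ℂ W] [FiniteDimensional ℂ W]
    [AddCommGroup X] [Module ℂ X] [AddCommGroup Y] [Module ℂ Y]
    (σ : ι → ι) (T : ι → W →ₗ[ℂ] W) (L : ι → X →ₗ[ℂ] X) (ρ : ι → Y →ₗ[ℂ] Y)
    (hT : ∀ i x y, inner ℂ (T (σ i) x) y = inner ℂ x (T i y))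
    (g : X →ₗ[ℂ] W) (f : X →ₗ[ℂ] Y)
    (hg : ∀ i x, T i (g x) = g (L i x)) (hf : ∀ i x, ρ i (f x) = f (L i x))
    (hker : ∀ x, g x = 0 → f x = 0) :
    ∃ (n : ℕ) (e : Fin n → Y) (m : ι → Matrix (Fin n) (Fin n) ℂ),
      LinearIndependent ℂ e ∧ Submodule.span ℂ (Set.range e) = LinearMap.range f ∧
      (∀ i j, ρ i (e j) = ∑ k, m i k j • e k) ∧
      ∀ i j k, m (σ i) j k = star (m i k j) := by
  set K : Submodule ℂ W := (LinearMap.ker f).map g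
  set N : Submodule ℂ W := LinearMap.range g ⊓ Kᗮ
  have hTN : ∀ i, ∀ w ∈ N, T i w ∈ N := by
    rintro i w ⟨⟨x, rfl⟩, hw⟩
    refine ⟨⟨L i x, (hg i x).symm⟩, ?_⟩
    rw [SetLike.mem_coe, Submodule.mem_orthogonal] at hw ⊢
    rintro _ ⟨z, hz, rfl⟩
    rw [← hT, hg]
    refine hw _ ⟨L (σ i) z, ?_, rfl⟩
    have hz : f z = 0 := hz
    change f _ = 0
    rw [← hf, hz, map_zero]
  let b := stdOrthonormalBasis ℂ N
  have hbx : ∀ j, ∃ x, g x = (b j : W) := fun j => (b j).2.1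
  choose x hx using hbx
  have hexp : ∀ w (hw : w ∈ N), w = ∑ k, inner ℂ (b k : W) w • (b k : W) := by
    intro w hw
    have := congrArg (Subtype.val) (b.sum_repr' ⟨w, hw⟩)
    simpa using this.symm
  have hlift : ∀ z w, g z = g w → f z = f w := fun z w h => by
    rw [← sub_eq_zero, ← map_sub]
    exact hker _ (by rw [map_sub, h, sub_self])
  refine ⟨_, fun j => f (x j), fun i k j => inner ℂ (b k : W) (T i (b j)), ?_, ?_, ?_, ?_⟩
  · rw [Fintype.linearIndependent_iff]
    intro c hc
    have h0 : ∑ j, c j • (b j : W) = 0 := by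
      have h1 : ∑ j, c j • (b j : W) ∈ K := by
        refine ⟨∑ j, c j • x j, ?_, by simp [hx]⟩
        change f _ = 0
        simpa using hc
      have h2 : ∑ j, c j • (b j : W) ∈ Kᗮ :=
        Submodule.sum_mem _ fun j _ => Submodule.smul_mem _ _ (b j).2.2
      exact (Submodule.mem_bot ℂ).1 (K.inf_orthogonal_eq_bot ▸ ⟨h1, h2⟩)
    have h3 : ∑ j, c j • b j = 0 := by
      apply Subtype.ext
      simpa using h0
    exact Fintype.linearIndependent_iff.1 b.orthonormal.linearIndependent c h3
  · apply le_antisymm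
    · rw [Submodule.span_le]
      rintro _ ⟨j, rfl⟩
      exact ⟨x j, rfl⟩
    · rintro _ ⟨z, rfl⟩
      obtain ⟨_, ⟨p, hp, rfl⟩, q, hq, hpq⟩ := K.exists_add_mem_mem_orthogonal (g z)
      have hp : f p = 0 := hp
      have hqN : q ∈ N := ⟨⟨z - p, by rw [map_sub, hpq, add_sub_cancel_left]⟩, hq⟩
      have : f z = f (p + ∑ k, inner ℂ (b k : W) q • x k) := by
        apply hlift
        rw [hpq, map_add, map_sum, hexp q hqN]
        simp [hx, ← hexp q hqN]
      rw [this, map_add, hp, zero_add, map_sum]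
      refine Submodule.sum_mem _ fun k _ => ?_
      rw [map_smul]
      exact Submodule.smul_mem _ _ (Submodule.subset_span ⟨k, rfl⟩)
  · intro i j
    rw [hf]
    simp only [← map_smul, ← map_sum]
    apply hlift
    rw [← hg, hx, hexp _ (hTN i _ (b j).2)]
    simp [hx, ← hexp _ (hTN i _ (b j).2)]
  · intro i j k
    change inner ℂ _ _ = (starRingEnd ℂ) (inner ℂ _ _)
    rw [← hT i (b k), inner_conj_symm]

/-! ### Matrix coefficients in a Hopf algebra -/

section Antipode

variable {Q : Type w} [Ring Q] [HopfAlgebra ℂ Q] {κ : Type*} [Fintype κ] [DecidableEq κ]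
  {u : Matrix κ κ Q}

theorem map_antipode_mul_self
    (hΔ : ∀ i j, Coalgebra.comul (R := ℂ) (u i j) = ∑ l, u i l ⊗ₜ[ℂ] u l j)
    (hε : ∀ i j, Coalgebra.counit (R := ℂ) (u i j) = if i = j then 1 else 0) :
    u.map (HopfAlgebra.antipode ℂ) * u = 1 := by
  ext i j
  have := HopfAlgebra.mul_antipode_rTensor_comul_apply (R := ℂ) (u i j)
  rw [hΔ, hε] at this
  simp only [map_sum, LinearMap.rTensor_tmul, LinearMap.mul'_apply] at this
  rw [Matrix.mul_apply, Matrix.one_apply]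
  simp only [Matrix.map_apply]
  rw [this]
  split <;> simp

theorem mul_map_antipode_self
    (hΔ : ∀ i j, Coalgebra.comul (R := ℂ) (u i j) = ∑ l, u i l ⊗ₜ[ℂ] u l j)
    (hε : ∀ i j, Coalgebra.counit (R := ℂ) (u i j) = if i = j then 1 else 0) :
    u * u.map (HopfAlgebra.antipode ℂ) = 1 := by
  ext i j
  have := HopfAlgebra.mul_antipode_lTensor_comul_apply (R := ℂ) (u i j)
  rw [hΔ, hε] at this
  simp only [map_sum, LinearMap.lTensor_tmul, LinearMap.mul'_apply] at this
  rw [Matrix.mul_apply, Matrix.one_apply]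
  simp only [Matrix.map_apply]
  rw [this]
  split <;> simp

variable [StarRing Q]

theorem IsUnitaryCorep.antipode_eq_star {n : ℕ} {t : Matrix (Fin n) (Fin n) Q}
    [StarModule ℂ Q] (ht : IsUnitaryCorep t) (i j : Fin n) :
    HopfAlgebra.antipode ℂ (t i j) = star (t j i) := by
  have h := left_inv_eq_right_inv (map_antipode_mul_self ht.comul_eq ht.counit_eq)
    (Unitary.mul_star_self_of_mem ht.unitary)
  exact congrFun (congrFun h i) j

/-- Finitely many elements of `Q` lie in the span of the entries of a single matrix `t`, a direct sum
of unitary corepresentations. -/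
theorem IsCompactQuantumGroupAlgebra.exists_matrix_span [StarModule ℂ Q]
    (hQ : IsCompactQuantumGroupAlgebra Q) {s : Set Q} (hs : s.Finite) :
    ∃ (κ : Type w) (_ : Fintype κ) (_ : DecidableEq κ) (t : Matrix κ κ Q),
      (∀ i j, Coalgebra.comul (R := ℂ) (t i j) = ∑ l, t i l ⊗ₜ[ℂ] t l j) ∧
      (∀ i j, HopfAlgebra.antipode ℂ (t i j) = star (t j i)) ∧
      s ⊆ Submodule.span ℂ (Set.range fun p : κ × κ => t p.1 p.2) := by
  classical
  have hle : (hs.toFinset : Set Q) ⊆ Submodule.span ℂ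
    {x : Q | ∃ (n : ℕ) (t : Matrix (Fin n) (Fin n) Q) (i j : Fin n),
      IsUnitaryCorep t ∧ x = t i j} := by
    rw [hQ.span_coeff]; exact fun _ _ => trivial
  obtain ⟨F, hF, hsF⟩ := Submodule.subset_span_finite_of_subset_span hle
  have hF' : ∀ x : F, ∃ (n : ℕ) (t : Matrix (Fin n) (Fin n) Q) (i j : Fin n),
      IsUnitaryCorep t ∧ (x : Q) = t i j := fun x => hF x.2
  choose n t i j ht hx using hF'
  refine ⟨Σ x : F, Fin (n x), inferInstance, inferInstance, Matrix.blockDiagonal' t, ?_, ?_, ?_⟩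
  · rintro ⟨x, a⟩ ⟨y, b⟩
    rw [Fintype.sum_sigma, Finset.sum_eq_single x]
    · simp only [Matrix.blockDiagonal'_apply_eq]
      by_cases h : x = y
      · subst h
        simp [(ht x).comul_eq]
      · simp [Matrix.blockDiagonal'_apply_ne _ _ _ h]
    · intro z _ hz
      simp [Matrix.blockDiagonal'_apply_ne _ _ _ hz.symm]
    · simp
  · rintro ⟨x, a⟩ ⟨y, b⟩
    by_cases h : x = y
    · subst h
      simp [(ht x).antipode_eq_star]
    · simp [Matrix.blockDiagonal'_apply_ne _ _ _ h, Matrix.blockDiagonal'_apply_ne _ _ _ (Ne.symm h)]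
  · intro y hy
    have hy' := hsF (by simpa using hy : y ∈ (hs.toFinset : Set Q))
    refine Submodule.span_mono ?_ hy'
    intro z hz
    refine ⟨(⟨⟨z, hz⟩, i ⟨z, hz⟩⟩, ⟨⟨z, hz⟩, j ⟨z, hz⟩⟩), ?_⟩
    simp only [Matrix.blockDiagonal'_apply_eq]
    exact (hx ⟨z, hz⟩).symm

end Antipode

/-! ### Tensors and linear independence -/

section Tensor

variable {ι M N : Type*} [AddCommGroup M] [Module ℂ M] [AddCommGroup N] [Module ℂ N]

theorem LinearIndependent.exists_dual {e : ι → M} (he : LinearIndependent ℂ e) [DecidableEq ι]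
    (i : ι) : ∃ f : M →ₗ[ℂ] ℂ, ∀ j, f (e j) = if j = i then 1 else 0 := by
  obtain ⟨f, hf⟩ := LinearMap.exists_extend ((Module.Basis.span he).coord i)
  refine ⟨f, fun j => ?_⟩
  have h : f (Module.Basis.span he j : M) = (Module.Basis.span he).repr (Module.Basis.span he j) i :=
    LinearMap.congr_fun hf _
  rwa [Module.Basis.repr_self, Finsupp.single_apply, Module.Basis.span_apply] at h

variable [Fintype ι]

theorem LinearIndependent.sum_tmul_left_injective {e : ι → M} (he : LinearIndependent ℂ e)
    {x y : ι → N} (h : ∑ i, e i ⊗ₜ[ℂ] x i = ∑ i, e i ⊗ₜ[ℂ] y i) : x = y := by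
  classical
  funext i
  obtain ⟨f, hf⟩ := he.exists_dual i
  simpa [hf, ite_smul, TensorProduct.ite_tmul] using
    congrArg (TensorProduct.lid ℂ N ∘ f.rTensor N) h

theorem Submodule.mem_range_rTensor_subtype {V : Submodule ℂ M} {e : ι → M}
    (he : Submodule.span ℂ (Set.range e) = V) {z : M ⊗[ℂ] N}
    (hz : z ∈ LinearMap.range (V.subtype.rTensor N)) : ∃ x : ι → N, z = ∑ i, e i ⊗ₜ[ℂ] x i := by
  obtain ⟨z, rfl⟩ := hz
  induction z with
  | zero => exact ⟨0, by simp⟩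
  | add a b ha hb =>
    obtain ⟨x, hx⟩ := ha
    obtain ⟨y, hy⟩ := hb
    exact ⟨x + y, by simp [hx, hy, TensorProduct.tmul_add, Finset.sum_add_distrib]⟩
  | tmul v n =>
    obtain ⟨v, hv⟩ := v
    subst he
    obtain ⟨c, rfl⟩ := (Submodule.mem_span_range_iff_exists_fun ℂ).1 hv
    exact ⟨fun i => c i • n, by simp [TensorProduct.sum_tmul, TensorProduct.smul_tmul]⟩

theorem eq_of_forall_dual {x y : N} (h : ∀ f : Module.Dual ℂ N, f x = f y) : x = y := by
  rw [← sub_eq_zero, ← Module.forall_dual_apply_eq_zero_iff ℂ]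
  intro f
  rw [map_sub, h, sub_self]

end Tensor

theorem mem_symRel_of_injective {k : Type u} [Field k] {A : Type v} [CommRing A] [Algebra k A]
    {V : Type v} [AddCommGroup V] [Module k V] {f : V →ₗ[k] A}
    (hf : Function.Injective (symSqToAlgebra f)) {y : V ⊗[k] V}
    (hy : LinearMap.mul' k A (TensorProduct.map f f y) = 0) : y ∈ symRel k V := by
  have h : symSqToAlgebra f ((symRel k V).mkQ y) = 0 := hy
  rw [← map_zero (symSqToAlgebra f)] at h
  exact (Submodule.Quotient.mk_eq_zero _).1 (hf h)

/-! ### The coefficient matrix of an invariant subspace -/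

namespace HopfCoaction

variable {A : Type v} [CommRing A] [Algebra ℂ A] {Q : Type w} [Ring Q] [HopfAlgebra ℂ Q]
  (α : HopfCoaction ℂ A Q)

/-- The action `a ↦ (id ⊗ ψ) α(a)` on `A` of a linear functional `ψ` on `Q`. -/
noncomputable def dualAction (ψ : Module.Dual ℂ Q) : A →ₗ[ℂ] A :=
  (TensorProduct.rid ℂ A).toLinearMap ∘ₗ ψ.lTensor A ∘ₗ α.toAlgHom.toLinearMap

variable {ι : Type*} [Fintype ι] {e : ι → A} {u : Matrix ι ι Q} {V : Submodule ℂ A}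

/-- `u` is the coefficient matrix of the coaction on the span of the family `e`:
`α (e j) = ∑ i, e i ⊗ u i j`. -/
def IsCoeffMatrix (e : ι → A) (u : Matrix ι ι Q) : Prop :=
  ∀ j, α.toAlgHom (e j) = ∑ i, e i ⊗ₜ[ℂ] u i j

variable {α}

theorem Preserves.exists_isCoeffMatrix (hV : α.Preserves V)
    (he : Submodule.span ℂ (Set.range e) = V) : ∃ u : Matrix ι ι Q, α.IsCoeffMatrix e u := by
  have h : ∀ j, ∃ x : ι → Q, α.toAlgHom (e j) = ∑ i, e i ⊗ₜ[ℂ] x i := fun j =>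
    Submodule.mem_range_rTensor_subtype he (hV _ (he ▸ Submodule.subset_span ⟨j, rfl⟩))
  choose x hx using h
  exact ⟨fun i j => x j i, hx⟩

theorem IsCoeffMatrix.dualAction_apply (hu : α.IsCoeffMatrix e u) (ψ : Module.Dual ℂ Q) (j : ι) :
    α.dualAction ψ (e j) = ∑ i, ψ (u i j) • e i := by
  change TensorProduct.rid ℂ A (ψ.lTensor A (α.toAlgHom (e j))) = _
  rw [hu j]
  simp

theorem IsCoeffMatrix.comul_eq (hu : α.IsCoeffMatrix e u) (he : LinearIndependent ℂ e) (i j : ι) :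
    Coalgebra.comul (R := ℂ) (u i j) = ∑ l, u i l ⊗ₜ[ℂ] u l j := by
  have h := α.coassoc (e j)
  rw [hu j] at h
  simp only [map_sum, LinearMap.rTensor_tmul, AlgHom.toLinearMap_apply, hu _,
    TensorProduct.sum_tmul, TensorProduct.assoc_tmul, LinearMap.lTensor_tmul] at h
  rw [Finset.sum_comm] at h
  simp only [← TensorProduct.tmul_sum] at h
  exact (congrFun (he.sum_tmul_left_injective h) i).symm

theorem IsCoeffMatrix.counit_eq [DecidableEq ι] (hu : α.IsCoeffMatrix e u)
    (he : LinearIndependent ℂ e) (i j : ι) :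
    Coalgebra.counit (R := ℂ) (u i j) = if i = j then 1 else 0 := by
  have h := α.counit (e j)
  rw [hu j] at h
  simp only [map_sum, LinearMap.lTensor_tmul, TensorProduct.rid_tmul] at h
  have h2 : ∑ i, (Coalgebra.counit (R := ℂ) (u i j) - if i = j then 1 else 0) • e i = 0 := by
    simp [sub_smul, h, ite_smul]
  exact sub_eq_zero.1 (Fintype.linearIndependent_iff.1 he _ h2 i)

/-- The entries of the coefficient matrix satisfy `[u a i, u b j] = [u a j, u b i]`, by comparing
the coefficients of `e a * e b` in `α (e i) α (e j) = α (e j) α (e i)`. -/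
theorem IsCoeffMatrix.commutator_swap (hquad : QuadraticallyIndependent V)
    (hu : α.IsCoeffMatrix e u) (he : LinearIndependent ℂ e)
    (heV : Submodule.span ℂ (Set.range e) = V) (a b i j : ι) :
    u a i * u b j - u b j * u a i = u a j * u b i - u b i * u a j := by
  classical
  have hmem : ∀ i, e i ∈ V := fun i => heV ▸ Submodule.subset_span ⟨i, rfl⟩
  let e' : ι → V := fun i => ⟨e i, hmem i⟩
  have he' : LinearIndependent ℂ e' := LinearIndependent.of_comp V.subtype he
  have hA : ∑ p, ∑ q, (e p * e q) ⊗ₜ[ℂ] (u p i * u q j - u p j * u q i) = 0 := by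
    have h : α.toAlgHom (e i) * α.toAlgHom (e j) = α.toAlgHom (e j) * α.toAlgHom (e i) := by
      rw [← map_mul, mul_comm, map_mul]
    simp only [hu _, Finset.sum_mul_sum, Algebra.TensorProduct.tmul_mul_tmul] at h
    simp only [TensorProduct.tmul_sub, Finset.sum_sub_distrib, h, sub_self]
  refine eq_of_forall_dual fun ψ => ?_
  obtain ⟨f, hf⟩ := he'.exists_dual a
  obtain ⟨g, hg⟩ := he'.exists_dual b
  set y : V ⊗[ℂ] V := ∑ p, ∑ q, ψ (u p i * u q j - u p j * u q i) • (e' p ⊗ₜ[ℂ] e' q) with hy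
  have hyrel : y ∈ symRel ℂ V := by
    refine mem_symRel_of_injective hquad ?_
    have := congrArg (TensorProduct.rid ℂ A ∘ ψ.lTensor A) hA
    simp only [Function.comp_apply, map_sum, LinearMap.lTensor_tmul, TensorProduct.rid_tmul,
      map_zero] at this
    simpa only [hy, map_sum, map_smul, TensorProduct.map_tmul, Submodule.subtype_apply,
      LinearMap.mul'_apply] using this
  -- The symmetric functional `f ⊗ g + g ⊗ f` vanishes on `symRel` and picks out the sum of the
  -- coefficients of `e a ⊗ e b` and `e b ⊗ e a`.
  have hker : symRel ℂ V ≤ LinearMap.ker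
      (LinearMap.mul' ℂ ℂ ∘ₗ (TensorProduct.map f g + TensorProduct.map g f)) := by
    refine Submodule.span_le.2 ?_
    rintro _ ⟨v, w, rfl⟩
    simp only [SetLike.mem_coe, LinearMap.mem_ker, LinearMap.comp_apply, LinearMap.add_apply,
      map_sub, TensorProduct.map_tmul, map_add, LinearMap.mul'_apply]
    ring
  have h := hker hyrel
  simp only [hy, LinearMap.mem_ker, map_sum, map_smul, LinearMap.comp_apply, LinearMap.add_apply,
    TensorProduct.map_tmul, map_add, LinearMap.mul'_apply, hf, hg] at h
  simp [mul_add, Finset.sum_add_distrib] at h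
  simp only [map_sub]
  linear_combination h

end HopfCoaction

/-! ### The dual algebra and unitarizability -/

section DualAlgebra

variable {Q : Type w} [Ring Q] [HopfAlgebra ℂ Q]

/-- Left convolution by `ψ` on the dual of `Q`: `φ ↦ (ψ ⊗ φ) ∘ Δ`. -/
noncomputable def dualConvolution (ψ : Module.Dual ℂ Q) :
    Module.Dual ℂ Q →ₗ[ℂ] Module.Dual ℂ Q where
  toFun φ := LinearMap.mul' ℂ ℂ ∘ₗ TensorProduct.map ψ φ ∘ₗ Coalgebra.comul
  map_add' φ φ' := by
    ext x
    simp [TensorProduct.map_add_right]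
  map_smul' c φ := by
    ext x
    simp [TensorProduct.map_smul_right]

theorem dualConvolution_apply {κ : Type*} [Fintype κ] {t : Matrix κ κ Q}
    (hΔ : ∀ i j, Coalgebra.comul (R := ℂ) (t i j) = ∑ l, t i l ⊗ₜ[ℂ] t l j)
    (ψ φ : Module.Dual ℂ Q) (i j : κ) :
    dualConvolution ψ φ (t i j) = ∑ l, ψ (t i l) * φ (t l j) := by
  change LinearMap.mul' ℂ ℂ (TensorProduct.map ψ φ (Coalgebra.comul (t i j))) = _
  simp [hΔ]

variable [StarRing Q] [StarModule ℂ Q]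

/-- The involution `ψ ↦ conj ψ(S(·)^*)` of the dual of `Q`. -/
noncomputable def dualStar (ψ : Module.Dual ℂ Q) : Module.Dual ℂ Q where
  toFun x := star (ψ (star (HopfAlgebra.antipode ℂ x)))
  map_add' x y := by simp
  map_smul' c x := by simp

theorem dualStar_apply (ψ : Module.Dual ℂ Q) (x : Q) :
    dualStar ψ x = star (ψ (star (HopfAlgebra.antipode ℂ x))) := rfl

end DualAlgebra

namespace HopfCoaction

variable {A : Type v} [CommRing A] [Algebra ℂ A] {Q : Type w} [Ring Q] [HopfAlgebra ℂ Q]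
  [StarRing Q] {α : HopfCoaction ℂ A Q} {V : Submodule ℂ A}

/-- A finite-dimensional invariant subspace is unitarizable: it has a basis whose coefficient matrix
satisfies `S (u i j) = (u j i)^*`, that is, is unitary. -/
theorem Preserves.exists_isCoeffMatrix_antipode_eq_star [StarModule ℂ Q]
    (hQ : IsCompactQuantumGroupAlgebra Q) [FiniteDimensional ℂ V] (hV : α.Preserves V) :
    ∃ (n : ℕ) (e : Fin n → A) (u : Matrix (Fin n) (Fin n) Q), LinearIndependent ℂ e ∧
      Submodule.span ℂ (Set.range e) = V ∧ α.IsCoeffMatrix e u ∧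
      ∀ i j, HopfAlgebra.antipode ℂ (u i j) = star (u j i) := by
  classical
  let b := Module.finBasis ℂ V
  set d := Module.finrank ℂ V
  let b' : Fin d → A := fun i => b i
  have hb : LinearIndependent ℂ b' := b.linearIndependent.map' V.subtype V.ker_subtype
  have hbV : Submodule.span ℂ (Set.range b') = V := by
    have : Set.range b' = V.subtype '' Set.range b := by
      rw [← Set.range_comp]; rfl
    rw [this, Submodule.span_image, b.span_eq, Submodule.map_top, Submodule.range_subtype]
  obtain ⟨x, hx⟩ := hV.exists_isCoeffMatrix hbV
  obtain ⟨κ, _, _, t, htΔ, htS, hxt⟩ :=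
    hQ.exists_matrix_span (Set.finite_range fun p : Fin d × Fin d => x p.1 p.2)
  have hxΔ := hx.comul_eq hb
  -- The Hilbert space is the sum of `d * |κ|` copies of the space on which `t` acts, the copies
  -- being indexed by the first and last components of the index.
  let T : Module.Dual ℂ Q → EuclideanSpace ℂ (Fin d × κ × κ) →ₗ[ℂ]
      EuclideanSpace ℂ (Fin d × κ × κ) := fun ψ =>
    { toFun := fun w => WithLp.toLp 2 fun p => ∑ l, ψ (t p.2.1 l) * w (p.1, l, p.2.2)
      map_add' := fun w w' => by
        ext p
        simp [mul_add, Finset.sum_add_distrib]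
      map_smul' := fun c w => by
        ext p
        simp [Finset.mul_sum, mul_left_comm] }
  -- `g` evaluates functionals on the entries of `t`; `f` is the surjection onto `V`.
  let g : (Fin d → Module.Dual ℂ Q) →ₗ[ℂ] EuclideanSpace ℂ (Fin d × κ × κ) :=
    { toFun := fun φ => WithLp.toLp 2 fun p => φ p.1 (t p.2.1 p.2.2)
      map_add' := fun φ φ' => by ext p; simp
      map_smul' := fun c φ => by ext p; simp }
  let f : (Fin d → Module.Dual ℂ Q) →ₗ[ℂ] A :=
    { toFun := fun φ => ∑ i, α.dualAction (φ i) (b' i)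
      map_add' := fun φ φ' => by
        simp [hx.dualAction_apply, add_smul, Finset.sum_add_distrib]
      map_smul' := fun c φ => by
        simp [hx.dualAction_apply, Finset.smul_sum, mul_smul] }
  have hfapp : ∀ φ, f φ = ∑ i, ∑ k, φ i (x k i) • b' k := by
    intro φ
    change ∑ i, α.dualAction (φ i) (b' i) = _
    simp only [hx.dualAction_apply]
  let L : Module.Dual ℂ Q → (Fin d → Module.Dual ℂ Q) →ₗ[ℂ] (Fin d → Module.Dual ℂ Q) :=
    fun ψ => LinearMap.pi fun i => dualConvolution ψ ∘ₗ LinearMap.proj i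
  have hL : ∀ ψ φ i, L ψ φ i = dualConvolution ψ (φ i) := fun _ _ _ => rfl
  have hT : ∀ ψ y z, inner ℂ (T (dualStar ψ) y) z = inner ℂ y (T ψ z) := by
    intro ψ y z
    simp only [PiLp.inner_apply, Fintype.sum_prod_type]
    refine Finset.sum_congr rfl fun i _ => ?_
    rw [Finset.sum_comm]
    conv_rhs => rw [Finset.sum_comm]
    refine Finset.sum_congr rfl fun c _ => ?_
    simp only [T, LinearMap.coe_mk, AddHom.coe_mk, RCLike.inner_apply, dualStar_apply, htS,
      star_star, map_sum, map_mul, Finset.mul_sum, Finset.sum_mul]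
    rw [Finset.sum_comm]
    refine Finset.sum_congr rfl fun a _ => Finset.sum_congr rfl fun l _ => ?_
    rw [starRingEnd_apply, star_star]
    ring
  have hg : ∀ ψ φ, T ψ (g φ) = g (L ψ φ) := by
    intro ψ φ
    ext p
    simp [T, g, hL, dualConvolution_apply htΔ]
  have hf : ∀ ψ φ, α.dualAction ψ (f φ) = f (L ψ φ) := by
    intro ψ φ
    simp only [hfapp, hL, map_sum, map_smul, hx.dualAction_apply, dualConvolution_apply hxΔ,
      Finset.sum_smul, Finset.smul_sum, smul_smul]
    refine Finset.sum_congr rfl fun i _ => ?_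
    rw [Finset.sum_comm]
    simp only [mul_comm]
  have hker : ∀ φ, g φ = 0 → f φ = 0 := by
    intro φ hφ
    have h0 : ∀ i a c, φ i (t a c) = 0 := fun i a c =>
      congrArg (fun w : EuclideanSpace ℂ (Fin d × κ × κ) => w (i, a, c)) hφ
    have h1 : ∀ i k, φ i (x k i) = 0 := by
      intro i k
      have hle : Submodule.span ℂ (Set.range fun p : κ × κ => t p.1 p.2) ≤
          LinearMap.ker (φ i) := by
        rw [Submodule.span_le]
        rintro _ ⟨p, rfl⟩
        exact h0 i p.1 p.2
      exact hle (hxt ⟨(k, i), rfl⟩)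
    simp [hfapp, h1]
  have hrange : LinearMap.range f = V := by
    apply le_antisymm
    · rintro _ ⟨φ, rfl⟩
      rw [hfapp]
      exact Submodule.sum_mem _ fun i _ => Submodule.sum_mem _ fun k _ =>
        Submodule.smul_mem _ _ (b k).2
    · rw [← hbV, Submodule.span_le]
      rintro _ ⟨i, rfl⟩
      refine ⟨Pi.single i Coalgebra.counit, ?_⟩
      rw [hfapp, Finset.sum_eq_single i]
      · simp [hx.counit_eq hb, ite_smul]
      · intro j _ hj
        simp [Pi.single_eq_of_ne hj]
      · simp
  obtain ⟨n, e, m, he, heV, hm, hmstar⟩ :=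
    exists_basis_conjTranspose_of_adjoint_family dualStar T L α.dualAction hT g f hg hf hker
  rw [hrange] at heV
  obtain ⟨u, hu⟩ := hV.exists_isCoeffMatrix heV
  refine ⟨n, e, u, he, heV, hu, ?_⟩
  -- The matrices of the action determine `u`, since functionals separate the points of `Q`.
  have hmu : ∀ ψ i j, m ψ i j = ψ (u i j) := by
    intro ψ i j
    have h := hm ψ j
    rw [hu.dualAction_apply] at h
    have h2 : ∑ i, (m ψ i j - ψ (u i j)) • e i = 0 := by
      simp [sub_smul, h]
    exact sub_eq_zero.1 (Fintype.linearIndependent_iff.1 he _ h2 i)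
  intro i j
  refine star_injective (eq_of_forall_dual fun ψ => star_injective ?_)
  rw [← dualStar_apply, ← hmu, hmstar, hmu, star_star]

/-- The entries of a unitary coefficient matrix of a quadratically independent subspace commute with
each other. -/
theorem IsCoeffMatrix.commute (hquad : QuadraticallyIndependent V) {n : ℕ} {e : Fin n → A}
    {u : Matrix (Fin n) (Fin n) Q} (he : LinearIndependent ℂ e)
    (heV : Submodule.span ℂ (Set.range e) = V) (hu : α.IsCoeffMatrix e u)
    (hS : ∀ i j, HopfAlgebra.antipode ℂ (u i j) = star (u j i)) (a i b j : Fin n) :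
    u a i * u b j = u b j * u a i := by
  have h1 := hu.commutator_swap hquad he heV
  -- `x ↦ S(x)^*` is multiplicative and sends `u a i` to `u i a`.
  have h2 := congrArg (fun x => star (HopfAlgebra.antipode ℂ x)) (h1 i j a b)
  simp only [map_sub, HopfAlgebra.antipode_mul_antidistrib, hS, star_sub, star_mul, star_star] at h2
  have h3 := h1 a b i j
  have h4 : (2 : ℂ) • (u a i * u b j - u b j * u a i) = 0 := by
    rw [two_smul]
    nth_rewrite 1 [h3]
    rw [h2]
    abel
  rw [← sub_eq_zero]
  exact (smul_eq_zero.1 h4).resolve_left two_ne_zero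

end HopfCoaction

/-! ### The Hopf subalgebra generated by a unitary coefficient matrix -/

section Adjoin

variable {Q : Type w} [Ring Q] [HopfAlgebra ℂ Q] [StarRing Q] {n : ℕ}
  {u : Matrix (Fin n) (Fin n) Q}

/-- An element commuting with the entries of an invertible matrix commutes with those of its
inverse. -/
theorem Matrix.commute_apply_of_mul_eq_one {R κ : Type*} [Ring R] [Fintype κ] [DecidableEq κ]
    {M N : Matrix κ κ R} (h₁ : M * N = 1) (h₂ : N * M = 1) {x : R}
    (hx : ∀ i j, Commute x (M i j)) (i j : κ) : Commute x (N i j) := by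
  have hM : Commute (Matrix.diagonal fun _ => x) M := by
    ext i j
    simpa using (hx i j).eq
  have hN : Commute (Matrix.diagonal fun _ => x) N :=
    hM.units_inv_right (u := ⟨M, N, h₁, h₂⟩)
  simpa [Commute, SemiconjBy] using congrFun (congrFun hN.eq i) j

/-- The subalgebra generated by the entries of `u` and their adjoints. -/
def coeffSubalgebra (u : Matrix (Fin n) (Fin n) Q) : Subalgebra ℂ Q :=
  Algebra.adjoin ℂ {x | ∃ i j, x = u i j ∨ x = star (u i j)}

theorem mem_coeffSubalgebra (u : Matrix (Fin n) (Fin n) Q) (i j : Fin n) :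
    u i j ∈ coeffSubalgebra u :=
  Algebra.subset_adjoin ⟨i, j, Or.inl rfl⟩

theorem star_mem_coeffSubalgebra (u : Matrix (Fin n) (Fin n) Q) (i j : Fin n) :
    star (u i j) ∈ coeffSubalgebra u :=
  Algebra.subset_adjoin ⟨i, j, Or.inr rfl⟩

theorem commute_star_of_commute
    (hΔ : ∀ i j, Coalgebra.comul (R := ℂ) (u i j) = ∑ l, u i l ⊗ₜ[ℂ] u l j)
    (hε : ∀ i j, Coalgebra.counit (R := ℂ) (u i j) = if i = j then 1 else 0)
    (hS : ∀ i j, HopfAlgebra.antipode ℂ (u i j) = star (u j i))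
    (hcomm : ∀ a i b j, Commute (u a i) (u b j)) (a i b j : Fin n) :
    Commute (u a i) (star (u b j)) := by
  rw [← hS]
  exact Matrix.commute_apply_of_mul_eq_one (mul_map_antipode_self hΔ hε)
    (map_antipode_mul_self hΔ hε) (hcomm a i) j b

/-- On the adjoints of the entries of `u` the antipode is given by `S ((u i j)^*) = u j i`. Both the
transpose of `u` and the matrix of the `S ((u i j)^*)` are inverse to the entrywise adjoint of `u`:
the former since the entries commute with their adjoints, the latter by applying `S` to
`∑ l, S (u i l) * u l j = δ i j`. -/
theorem antipode_star_of_commute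
    (hΔ : ∀ i j, Coalgebra.comul (R := ℂ) (u i j) = ∑ l, u i l ⊗ₜ[ℂ] u l j)
    (hε : ∀ i j, Coalgebra.counit (R := ℂ) (u i j) = if i = j then 1 else 0)
    (hS : ∀ i j, HopfAlgebra.antipode ℂ (u i j) = star (u j i))
    (hcomm : ∀ a i b j, Commute (u a i) (u b j)) (i j : Fin n) :
    HopfAlgebra.antipode ℂ (star (u i j)) = u j i := by
  have h := map_antipode_mul_self hΔ hε
  have h₁ : u.transpose * u.map star = 1 := by
    ext a b
    have h' := congrFun (congrFun h b) a
    simp only [Matrix.mul_apply, Matrix.map_apply, hS, Matrix.transpose_apply] at h' ⊢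
    rw [Matrix.one_apply] at h' ⊢
    simp only [eq_comm (a := a)]
    rw [← h']
    exact Finset.sum_congr rfl fun l _ => (commute_star_of_commute hΔ hε hS hcomm l a l b).eq
  have h₂ : u.map star * (u.map star).map (HopfAlgebra.antipode ℂ) = 1 := by
    ext a b
    have h' := congrArg (HopfAlgebra.antipode ℂ) (congrFun (congrFun h b) a)
    simp only [Matrix.mul_apply, Matrix.map_apply, map_sum,
      HopfAlgebra.antipode_mul_antidistrib, hS] at h' ⊢
    rw [h', Matrix.one_apply, Matrix.one_apply]
    simp only [eq_comm (a := a)]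
    split <;> simp
  have h₃ := left_inv_eq_right_inv h₁ h₂
  exact (congrFun (congrFun h₃ i) j).symm

theorem coeffSubalgebra_commute
    (hΔ : ∀ i j, Coalgebra.comul (R := ℂ) (u i j) = ∑ l, u i l ⊗ₜ[ℂ] u l j)
    (hε : ∀ i j, Coalgebra.counit (R := ℂ) (u i j) = if i = j then 1 else 0)
    (hS : ∀ i j, HopfAlgebra.antipode ℂ (u i j) = star (u j i))
    (hcomm : ∀ a i b j, Commute (u a i) (u b j)) {x y : Q}
    (hx : x ∈ coeffSubalgebra u) (hy : y ∈ coeffSubalgebra u) : Commute x y := by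
  have hstar := commute_star_of_commute hΔ hε hS hcomm
  refine Algebra.commute_of_mem_adjoin_of_forall_mem_commute hy fun z hz => ?_
  refine (Algebra.commute_of_mem_adjoin_of_forall_mem_commute hx fun w hw => ?_).symm
  obtain ⟨a, i, rfl | rfl⟩ := hz <;> obtain ⟨b, j, rfl | rfl⟩ := hw
  · exact hcomm _ _ _ _
  · exact hstar _ _ _ _
  · exact (hstar _ _ _ _).symm
  · exact (hcomm _ _ _ _).star_star

theorem isHopfSubalgebra_coeffSubalgebra [StarModule ℂ Q] (hQ : IsHopfStarAlgebra Q)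
    (hΔ : ∀ i j, Coalgebra.comul (R := ℂ) (u i j) = ∑ l, u i l ⊗ₜ[ℂ] u l j)
    (hε : ∀ i j, Coalgebra.counit (R := ℂ) (u i j) = if i = j then 1 else 0)
    (hS : ∀ i j, HopfAlgebra.antipode ℂ (u i j) = star (u j i))
    (hcomm : ∀ a i b j, Commute (u a i) (u b j)) : IsHopfSubalgebra (coeffSubalgebra u) where
  comul_mem := by
    have hle : coeffSubalgebra u ≤ (Algebra.TensorProduct.map (coeffSubalgebra u).val
        (coeffSubalgebra u).val).range.comap (Bialgebra.comulAlgHom ℂ Q) := by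
      refine Algebra.adjoin_le ?_
      rintro _ ⟨i, j, rfl | rfl⟩
      · rw [SetLike.mem_coe, Subalgebra.mem_comap, Bialgebra.comulAlgHom_apply, hΔ]
        exact Subalgebra.sum_mem _ fun l _ =>
          ⟨⟨_, mem_coeffSubalgebra u i l⟩ ⊗ₜ ⟨_, mem_coeffSubalgebra u l j⟩, rfl⟩
      · rw [SetLike.mem_coe, Subalgebra.mem_comap, Bialgebra.comulAlgHom_apply, hQ, hΔ, star_sum]
        exact Subalgebra.sum_mem _ fun l _ =>
          ⟨⟨_, star_mem_coeffSubalgebra u i l⟩ ⊗ₜ ⟨_, star_mem_coeffSubalgebra u l j⟩, rfl⟩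
    exact fun h hh => hle hh
  antipode_mem h hh := by
    induction hh using Algebra.adjoin_induction with
    | mem x hx =>
      obtain ⟨i, j, rfl | rfl⟩ := hx
      · rw [hS]
        exact star_mem_coeffSubalgebra u j i
      · rw [antipode_star_of_commute hΔ hε hS hcomm]
        exact mem_coeffSubalgebra u j i
    | algebraMap r =>
      rw [Algebra.algebraMap_eq_smul_one, map_smul, HopfAlgebra.antipode_one]
      exact Subalgebra.smul_mem _ (one_mem _) r
    | add x y _ _ hx hy => rw [map_add]; exact add_mem hx hy
    | mul x y _ _ hx hy =>
      rw [HopfAlgebra.antipode_mul_antidistrib]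
      exact mul_mem hy hx

theorem HopfCoaction.IsCoeffMatrix.factorsThrough {A : Type v} [CommRing A] [Algebra ℂ A]
    {α : HopfCoaction ℂ A Q} {e : Fin n → A} (hu : α.IsCoeffMatrix e u)
    (hgen : Algebra.adjoin ℂ (Submodule.span ℂ (Set.range e) : Set A) = ⊤) :
    α.FactorsThrough (coeffSubalgebra u) := by
  have hle : Algebra.adjoin ℂ (Submodule.span ℂ (Set.range e) : Set A) ≤
      (Algebra.TensorProduct.map (AlgHom.id ℂ A) (coeffSubalgebra u).val).range.comap
        α.toAlgHom := by
    rw [Algebra.adjoin_span]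
    refine Algebra.adjoin_le ?_
    rintro _ ⟨j, rfl⟩
    rw [SetLike.mem_coe, Subalgebra.mem_comap, hu j]
    exact Subalgebra.sum_mem _ fun i _ => ⟨e i ⊗ₜ ⟨_, mem_coeffSubalgebra u i j⟩, rfl⟩
  rw [hgen] at hle
  exact fun a => hle (x := a) trivial

end Adjoin

theorem corollary2p8
    {A : Type v} [CommRing A] [Algebra ℂ A]
    {Q : Type w} [Ring Q] [HopfAlgebra ℂ Q] [StarRing Q] [StarModule ℂ Q]
    (hQ : IsCompactQuantumGroupAlgebra Q)
    (V : Submodule ℂ A) [FiniteDimensional ℂ V]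
    (hgen : Algebra.adjoin ℂ (V : Set A) = ⊤)
    (hquad : QuadraticallyIndependent V)
    (α : HopfCoaction ℂ A Q)
    (hV : α.Preserves V)
    (hα : α.InnerFaithful) :
    ∀ x y : Q, x * y = y * x := by
  obtain ⟨n, e, u, he, heV, hu, hS⟩ := hV.exists_isCoeffMatrix_antipode_eq_star hQ
  have hΔ := hu.comul_eq he
  have hε := hu.counit_eq he
  have hcomm : ∀ a i b j, Commute (u a i) (u b j) := hu.commute hquad he heV hS
  have htop : coeffSubalgebra u = ⊤ :=
    hα _ (isHopfSubalgebra_coeffSubalgebra hQ.hopfStar hΔ hε hS hcomm)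
      (hu.factorsThrough (by rw [heV, hgen]))
  intro x y
  exact (coeffSubalgebra_commute hΔ hε hS hcomm (by rw [htop]; trivial)
    (by rw [htop]; trivial)).eq
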